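/- **Language and rules.** Let $\mathcal L$ be a language of predicate logic without equality, with connectives $\bot,\neg,\wedge,\vee,\to,\leftrightarrow$ ($\top:=\neg\bot$) and quantifiers $\forall,\exists$; propositional logic is the quantifier-free fragment with $0$-ary relation symbols. Let $\Sigma$ be a set of sentences such that infinitely many of the constants $c_0,c_1,\dots$ do not occur in $\Sigma$. Let $D$ be a set of defeasible rules $\varphi(\mathbf x)\leadsto\psi(\mathbf x)$, where $\psi$ is a proposition or a negated rule $\mathbf{not}(\eta\leadsto\mu)$, and let $\overline D$ be the set of their ground instances. A *supporting element* is a premise $\sigma$, a test $\varphi?$, or a pair $(\mathcal S',\varphi\leadsto\psi)$ of a finite set $\mathcal S'$ of supporting elements and a ground rule. For a premise $e=\sigma$ put $\hat e=\sigma$, for a test $e=\varphi?$ put $\hat e=\varphi$, and for $e=(\mathcal S',\eta\leadsto\mu)$ put $\hat e=\mu$. For a finite set $\mathcal S$ of supporting elements let $\hat{\mathcal S}$ be the set of the propositions among the $\hat e$, $e\in\mathcal S$. **Tableaux.** A tableau is a finite tree whose nodes are sets of arguments $(\mathcal S,\varphi)$, where a child contains all arguments of its parent. The root is $\Gamma_0=\{(\{\sigma\},\sigma)\mid\sigma\in\Sigma\}$.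 The steps are the following. * The usual rules with one child: from $(\mathcal S,\varphi\wedge\psi)$ add $(\mathcal S,\varphi),(\mathcal S,\psi)$; from $(\mathcal S,\varphi\leftrightarrow\psi)$ add $(\mathcal S,\varphi\to\psi),(\mathcal S,\psi\to\varphi)$; from $(\mathcal S,\neg(\varphi\vee\psi))$ add $(\mathcal S,\neg\varphi),(\mathcal S,\neg\psi)$; from $(\mathcal S,\neg(\varphi\to\psi))$ add $(\mathcal S,\varphi),(\mathcal S,\neg\psi)$; from $(\mathcal S,\neg\neg\varphi)$ add $(\mathcal S,\varphi)$; from $(\mathcal S,\forall x\,\varphi)$ or $(\mathcal S,\neg\exists x\,\varphi)$ add $(\mathcal S,\varphi[x/t])$, respectively $(\mathcal S,\neg\varphi[x/t])$, where $t$ is a ground term that occurs in a claim of the node (or a new constant, if no ground term occurs in a claim of the node); from $(\mathcal S,\exists x\,\varphi)$ or $(\mathcal S,\neg\forall x\,\varphi)$ add $(\mathcal S,\varphi[x/c])$, respectively $(\mathcal S,\neg\varphi[x/c])$, where $c$ is a constant $c_i$ that does not occur in the node; from $(\mathcal S,\varphi)$ and $(\mathcal S',\neg\varphi)$ add $(\mathcal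 S\cup\mathcal S',\bot)$. * The rules with two children, which split $(\mathcal S,\varphi\vee\psi)$ into $(\mathcal S,\varphi)\mid(\mathcal S,\psi)$, $(\mathcal S,\varphi\to\psi)$ into $(\mathcal S,\neg\varphi)\mid(\mathcal S,\psi)$, $(\mathcal S,\neg(\varphi\wedge\psi))$ into $(\mathcal S,\neg\varphi)\mid(\mathcal S,\neg\psi)$, and $(\mathcal S,\neg(\varphi\leftrightarrow\psi))$ into $(\mathcal S,\neg(\varphi\to\psi))\mid(\mathcal S,\neg(\psi\to\varphi))$. * Rule application: if $\varphi\leadsto\psi\in\overline D$ and the node $\Gamma$ extended with the test $(\{\neg\varphi?\},\neg\varphi)$ is the root of a tableau (built by the same steps) whose closure has a support $\mathcal S\cup\{\neg\varphi?\}$ with $\mathcal S$ free of tests, then $\Gamma$ may get the single child $\Gamma\cup\{(\{(\mathcal S,\varphi\leadsto\psi)\},\psi)\}$. Here a support for the closure of a tableau with leaves $\Lambda_1,\dots,\Lambda_k$ is a union $\bigcup_i\mathcal S_i$ with $(\mathcal S_i,\bot)\in\Lambda_i$. A tableau *extends* $\mathcal T$ if it arises from $\mathcal T$ by further steps at leaves.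 **Local closures.** Propagate the arguments $(\mathcal S,\bot)$ from the leaves to the root. From the only child of a node, all of them are added to the node. If $(\mathcal S_0,\chi)$ was split in a node, with children $\Gamma_1,\Gamma_2$, add to the node every $(\mathcal S_1\cup\mathcal S_2,\bot)$ with $(\mathcal S_i,\bot)\in\Gamma_i$ and $\mathcal S_0\subseteq\mathcal S_i$ for $i=1,2$, and every $(\mathcal S_i,\bot)\in\Gamma_i$ with $\mathcal S_0\not\subseteq\mathcal S_i$. If then $(\mathcal S,\bot)\in\Gamma_0$, the set $\mathcal S$ is a *support for a local closure* of the tableau. **Cases.** A finite set $\mathcal S$ of supporting elements is a *case* of a tableau $\mathcal T$ if alternatives of $\mathcal T$ can be eliminated as follows: wherever an argument $(\mathcal S_0,\chi)$ with $\mathcal S_0\not\subseteq\mathcal S$ was split, exactly one of the two children is kept, whereas both children are kept (as sub-cases) where $\mathcal S_0\subseteq\mathcal S$; and each leaf that remains contains $(\{e\},\hat e)$ for every $e\in\mathcal S$. It is a *minimal inconsistent case* of $\mathcal T$ if moreover $\hat{\mathcal S}$ has no model, while $\hat{\mathcal S'}$ has a model for every proper subset $\mathcal S'\subsetneq\mathcal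 S$. **Proposition.** Let $\mathcal T$ be a tableau for $\Sigma$ and $D$, and let $\mathcal S=\{\sigma_1,\dots,\sigma_m,(\mathcal S_1,\eta_1\leadsto\mu_1),\dots,(\mathcal S_n,\eta_n\leadsto\mu_n)\}$ be a minimal inconsistent case of $\mathcal T$. Then there is a tableau $\mathcal T'$ for $\Sigma$ and $D$ which extends $\mathcal T$ and for which $\mathcal S$ is a support for a local closure. -/

import Mathlib

universe u v

namespace ArgTableau

/-! ### The logical language

First-order formulas without equality over the symbols of `L`.  `Fml L n` has the bound
(de Bruijn) variables `Fin n`; the natural numbers in `L.Term (ℕ ⊕ Fin n)` are individual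
constants `c₀, c₁, …`, available besides the constants of `L`.  A sentence is a `Fml L 0`, a ground
term is an `L.Term ℕ`.  Propositional logic is the fragment with `0`-ary relation symbols only and
without quantifiers: the tableau rules never lead out of it. -/

inductive Fml (L : FirstOrder.Language.{u, v}) : ℕ → Type (max u v)
  | rel {n k : ℕ} (R : L.Relations k) (ts : Fin k → L.Term (ℕ ⊕ Fin n)) : Fml L n
  | bot {n : ℕ} : Fml L n
  | neg {n : ℕ} (φ : Fml L n) : Fml L n
  | and {n : ℕ} (φ ψ : Fml L n) : Fml L n
  | or {n : ℕ} (φ ψ : Fml L n) : Fml L n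
  | imp {n : ℕ} (φ ψ : Fml L n) : Fml L n
  | iff {n : ℕ} (φ ψ : Fml L n) : Fml L n
  | all {n : ℕ} (φ : Fml L (n + 1)) : Fml L n
  | ex {n : ℕ} (φ : Fml L (n + 1)) : Fml L n

variable {L : FirstOrder.Language.{u, v}}

/-- `⊤` is the formula `¬ ⊥`. -/
def Fml.top {n : ℕ} : Fml L n := .neg .bot

/-- A substitution for the bound variables, moved under one more quantifier. -/
def liftSubst {n m : ℕ} (s : Fin n → L.Term (ℕ ⊕ Fin m)) : Fin (n + 1) → L.Term (ℕ ⊕ Fin (m + 1)) :=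
  Fin.snoc (fun i => (s i).relabel (Sum.map id Fin.castSucc)) (FirstOrder.Language.Term.var (Sum.inr (Fin.last m)))

/-- Simultaneous (capture-free) substitution of terms for the bound variables. -/
def Fml.subst : {n m : ℕ} → Fml L n → (Fin n → L.Term (ℕ ⊕ Fin m)) → Fml L m
  | _, _, .rel R ts, s =>
      .rel R fun i => (ts i).subst (Sum.elim (fun c => FirstOrder.Language.Term.var (Sum.inl c)) s)
  | _, _, .bot, _ => .bot
  | _, _, .neg φ, s => .neg (φ.subst s)
  | _, _, .and φ ψ, s => .and (φ.subst s) (ψ.subst s)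
  | _, _, .or φ ψ, s => .or (φ.subst s) (ψ.subst s)
  | _, _, .imp φ ψ, s => .imp (φ.subst s) (ψ.subst s)
  | _, _, .iff φ ψ, s => .iff (φ.subst s) (ψ.subst s)
  | _, _, .all φ, s => .all (φ.subst (liftSubst s))
  | _, _, .ex φ, s => .ex (φ.subst (liftSubst s))

/-- The ground instance `φ(t₁, …, tₙ)`. -/
def Fml.inst {n : ℕ} (φ : Fml L n) (t : Fin n → L.Term ℕ) : Fml L 0 :=
  φ.subst fun i => (t i).relabel Sum.inl

/-- The sentence `φ[x/t]`. -/
def Fml.inst1 (φ : Fml L 1) (t : L.Term ℕ) : Fml L 0 := φ.inst fun _ => t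

/-- Truth in a structure, under values `e` of the constants `cᵢ` and `x` of the variables. -/
def Fml.Realize {M : Type*} [L.Structure M] (e : ℕ → M) : {n : ℕ} → Fml L n → (Fin n → M) → Prop
  | _, .rel R ts, x => FirstOrder.Language.Structure.RelMap R fun i => (ts i).realize (Sum.elim e x)
  | _, .bot, _ => False
  | _, .neg φ, x => ¬ φ.Realize e x
  | _, .and φ ψ, x => φ.Realize e x ∧ ψ.Realize e x
  | _, .or φ ψ, x => φ.Realize e x ∨ ψ.Realize e x
  | _, .imp φ ψ, x => φ.Realize e x → ψ.Realize e x
  | _, .iff φ ψ, x => φ.Realize e x ↔ ψ.Realize e x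
  | _, .all φ, x => ∀ a : M, φ.Realize e (Fin.snoc x a)
  | _, .ex φ, x => ∃ a : M, φ.Realize e (Fin.snoc x a)

/-- A set of sentences is consistent if some interpretation (with nonempty domain) makes all of
them true. -/
def Consistent (Φ : Set (Fml L 0)) : Prop :=
  ∃ (M : Type (max u v)) (_ : Nonempty M) (_ : L.Structure M) (e : ℕ → M),
    ∀ φ ∈ Φ, φ.Realize e Fin.elim0

/-- `s` is a subterm of the given term. -/
def IsSubterm {α : Type} (s : L.Term α) : L.Term α → Prop
  | .var a => s = .var a
  | .func f ts => s = .func f ts ∨ ∃ i, IsSubterm s (ts i)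

/-- The ground term `s` occurs in the given formula.  In particular, the constant `c` occurs iff
the ground term `FirstOrder.Language.Term.var c` does. -/
def Fml.Occurs (s : L.Term ℕ) : {n : ℕ} → Fml L n → Prop
  | _, .rel _ ts => ∃ i, IsSubterm (s.relabel Sum.inl) (ts i)
  | _, .bot => False
  | _, .neg φ => φ.Occurs s
  | _, .and φ ψ => φ.Occurs s ∨ ψ.Occurs s
  | _, .or φ ψ => φ.Occurs s ∨ ψ.Occurs s
  | _, .imp φ ψ => φ.Occurs s ∨ ψ.Occurs s
  | _, .iff φ ψ => φ.Occurs s ∨ ψ.Occurs s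
  | _, .all φ => φ.Occurs s
  | _, .ex φ => φ.Occurs s

/-! ### Defeasible rules -/

/-- What an argument may support and a defeasible rule may have as its consequent: a proposition,
or a negated defeasible rule `not (η ⤳ μ)`. -/
inductive Claim (L : FirstOrder.Language.{u, v}) (n : ℕ) : Type (max u v)
  | prop (φ : Fml L n)
  | undercut (η μ : Fml L n)

def Claim.inst {n : ℕ} (t : Fin n → L.Term ℕ) : Claim L n → Claim L 0
  | .prop φ => .prop (φ.inst t)
  | .undercut η μ => .undercut (η.inst t) (μ.inst t)

def Claim.Occurs (s : L.Term ℕ) {n : ℕ} : Claim L n → Prop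
  | .prop φ => φ.Occurs s
  | .undercut η μ => η.Occurs s ∨ μ.Occurs s

/-- A defeasible rule `φ(x) ⤳ ψ(x)` with `n` free variables. -/
structure Rule (L : FirstOrder.Language.{u, v}) (n : ℕ) : Type (max u v) where
  ante : Fml L n
  cons : Claim L n

/-- The set of ground instances of a set of defeasible rules. -/
def groundInstances (D : Set (Σ n, Rule L n)) : Set (Rule L 0) :=
  {ρ | ∃ (n : ℕ) (r : Rule L n) (t : Fin n → L.Term ℕ),
    ⟨n, r⟩ ∈ D ∧ ρ = ⟨r.ante.inst t, r.cons.inst t⟩}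

/-! ### Supporting elements

A supporting element is a premise `σ`, a test `φ?`, or a pair `(S, φ ⤳ ψ)` of a finite set `S` of
supporting elements and a ground rule.  The type is built from trees with lists of subtrees, by
identifying lists with the same set of entries. -/

inductive PreElem (L : FirstOrder.Language.{u, v}) : Type (max u v)
  | prem (σ : Fml L 0)
  | test (φ : Fml L 0)
  | rule (S : List (PreElem L)) (ρ : Rule L 0)

inductive PreElem.Equiv : PreElem L → PreElem L → Prop
  | prem (σ : Fml L 0) : Equiv (.prem σ) (.prem σ)
  | test (φ : Fml L 0) : Equiv (.test φ) (.test φ)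
  | rule {S S' : List (PreElem L)} {ρ : Rule L 0} (f g : PreElem L → PreElem L)
      (hf : ∀ a ∈ S, f a ∈ S') (hf' : ∀ a ∈ S, Equiv a (f a))
      (hg : ∀ b ∈ S', g b ∈ S) (hg' : ∀ b ∈ S', Equiv (g b) b) :
      Equiv (.rule S ρ) (.rule S' ρ)

theorem PreElem.Equiv.refl : ∀ a : PreElem L, PreElem.Equiv a a
  | .prem σ => .prem σ
  | .test φ => .test φ
  | .rule S _ => .rule id id (fun _ h => h) (fun a _ => PreElem.Equiv.refl a)
      (fun _ h => h) (fun b _ => PreElem.Equiv.refl b)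

theorem PreElem.Equiv.symm {a b : PreElem L} (h : PreElem.Equiv a b) : PreElem.Equiv b a := by
  induction h with
  | prem σ => exact .prem σ
  | test φ => exact .test φ
  | rule f g hf _ hg _ ihf ihg => exact .rule g f hg ihg hf ihf

theorem PreElem.Equiv.trans {a b c : PreElem L} (h : PreElem.Equiv a b)
    (h' : PreElem.Equiv b c) : PreElem.Equiv a c := by
  induction h generalizing c with
  | prem σ => exact h'
  | test φ => exact h'
  | rule f g hf hf' hg hg' ihf ihg =>
    cases h' with
    | rule f₂ g₂ hf₂ hf₂' hg₂ hg₂' =>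
      exact .rule (f₂ ∘ f) (g ∘ g₂) (fun a ha => hf₂ _ (hf a ha))
        (fun a ha => ihf a ha (hf₂' _ (hf a ha))) (fun b hb => hg _ (hg₂ b hb))
        (fun b hb => ihg _ (hg₂ b hb) (hg₂' b hb))

instance PreElem.setoid (L : FirstOrder.Language.{u, v}) : Setoid (PreElem L) :=
  ⟨PreElem.Equiv, PreElem.Equiv.refl, PreElem.Equiv.symm, PreElem.Equiv.trans⟩

/-- The supporting elements. -/
def Elem (L : FirstOrder.Language.{u, v}) : Type (max u v) := Quotient (PreElem.setoid L)

noncomputable instance : DecidableEq (Elem L) := Classical.decEq _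

def Elem.prem (σ : Fml L 0) : Elem L := Quotient.mk (PreElem.setoid L) (.prem σ)

def Elem.test (φ : Fml L 0) : Elem L := Quotient.mk (PreElem.setoid L) (.test φ)

noncomputable def Elem.rule (S : Finset (Elem L)) (ρ : Rule L 0) : Elem L :=
  Quotient.mk (PreElem.setoid L) (.rule (S.toList.map Quotient.out) ρ)

def PreElem.hat : PreElem L → Claim L 0
  | .prem σ => .prop σ
  | .test φ => .prop φ
  | .rule _ ρ => ρ.cons

/-- The claim that a supporting element contributes: `σ` for a premise, `ψ` for
`(S, φ ⤳ ψ)`. -/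
def Elem.hat (e : Elem L) : Claim L 0 :=
  Quotient.lift PreElem.hat (fun _ _ h => by cases h <;> rfl) e

theorem Elem.hat_prem (σ : Fml L 0) : (Elem.prem σ).hat = .prop σ := rfl

theorem Elem.hat_test (φ : Fml L 0) : (Elem.test φ).hat = .prop φ := rfl

theorem Elem.hat_rule (S : Finset (Elem L)) (ρ : Rule L 0) : (Elem.rule S ρ).hat = ρ.cons := rfl

theorem Elem.prem_injective : Function.Injective (Elem.prem : Fml L 0 → Elem L) := by
  intro σ τ h
  cases Quotient.exact h
  rfl

theorem Elem.test_injective : Function.Injective (Elem.test : Fml L 0 → Elem L) := by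
  intro σ τ h
  cases Quotient.exact h
  rfl

theorem Elem.rule_inj {S S' : Finset (Elem L)} {ρ ρ' : Rule L 0} :
    Elem.rule S ρ = Elem.rule S' ρ' ↔ S = S' ∧ ρ = ρ' := by
  constructor
  · intro h
    have h₁ : PreElem.Equiv _ _ := Quotient.exact h
    cases h₁ with
    | rule f g hf hf' hg hg' =>
      refine ⟨?_, rfl⟩
      ext e
      constructor
      · intro he
        have hm : e.out ∈ S.toList.map Quotient.out :=
          List.mem_map.2 ⟨e, Finset.mem_toList.2 he, rfl⟩
        obtain ⟨d, hd, hde⟩ := List.mem_map.1 (hf _ hm)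
        have hq : e.out ≈ d.out := by rw [hde]; exact hf' _ hm
        rw [Quotient.out_equiv_out.1 hq]
        exact Finset.mem_toList.1 hd
      · intro he
        have hm : e.out ∈ S'.toList.map Quotient.out :=
          List.mem_map.2 ⟨e, Finset.mem_toList.2 he, rfl⟩
        obtain ⟨d, hd, hde⟩ := List.mem_map.1 (hg _ hm)
        have hq : d.out ≈ e.out := by rw [hde]; exact hg' _ hm
        rw [← Quotient.out_equiv_out.1 hq]
        exact Finset.mem_toList.1 hd
  · rintro ⟨rfl, rfl⟩
    rfl

theorem Elem.prem_ne_test (σ φ : Fml L 0) : Elem.prem σ ≠ Elem.test φ := by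
  intro h
  cases Quotient.exact h

theorem Elem.prem_ne_rule (σ : Fml L 0) (S : Finset (Elem L)) (ρ : Rule L 0) :
    Elem.prem σ ≠ Elem.rule S ρ := by
  intro h
  cases Quotient.exact h

theorem Elem.test_ne_rule (φ : Fml L 0) (S : Finset (Elem L)) (ρ : Rule L 0) :
    Elem.test φ ≠ Elem.rule S ρ := by
  intro h
  cases Quotient.exact h

/-- The constant `c` occurs in a supporting element. -/
inductive Elem.Mentions (c : ℕ) : Elem L → Prop
  | prem {σ : Fml L 0} : σ.Occurs (.var c) → Mentions c (Elem.prem σ)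
  | test {φ : Fml L 0} : φ.Occurs (.var c) → Mentions c (Elem.test φ)
  | ante {S : Finset (Elem L)} {ρ : Rule L 0} :
      ρ.ante.Occurs (.var c) → Mentions c (Elem.rule S ρ)
  | cons {S : Finset (Elem L)} {ρ : Rule L 0} :
      ρ.cons.Occurs (.var c) → Mentions c (Elem.rule S ρ)
  | supp {S : Finset (Elem L)} {ρ : Rule L 0} {e : Elem L} :
      e ∈ S → Mentions c e → Mentions c (Elem.rule S ρ)

/-! ### Tableau nodes and rewriting steps -/

/-- An argument: a support and what it supports. -/
abbrev Arg (L : FirstOrder.Language.{u, v}) : Type (max u v) := Finset (Elem L) × Claim L 0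

/-- The argument `(S, φ)` for a proposition `φ`. -/
def arg (S : Finset (Elem L)) (φ : Fml L 0) : Arg L := (S, .prop φ)

/-- A tableau node. Nodes are cumulative: a child contains the arguments of its parent. -/
abbrev Node (L : FirstOrder.Language.{u, v}) : Type (max u v) := Set (Arg L)

/-- The ground term `t` occurs in a claim of the node. -/
def TermOccurs (t : L.Term ℕ) (Γ : Node L) : Prop := ∃ a ∈ Γ, a.2.Occurs t

/-- The constant `c` is new: it occurs neither in a claim nor in a support of the node. -/
def Fresh (c : ℕ) (Γ : Node L) : Prop :=
  ∀ a ∈ Γ, ¬ a.2.Occurs (.var c) ∧ ∀ e ∈ a.1, ¬ e.Mentions c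

/-- The terms with which universal claims may be instantiated at a node: those that occur in it
(and a new constant, if no ground term at all occurs in it, domains being nonempty). -/
def Admissible (t : L.Term ℕ) (Γ : Node L) : Prop :=
  TermOccurs t Γ ∨ ((∀ s : L.Term ℕ, ¬ TermOccurs s Γ) ∧ ∃ c, Fresh c Γ ∧ t = .var c)

/-- The rewriting rules with one child: `OneChild Γ N` if the arguments `N` may be added to `Γ`. -/
inductive OneChild (Γ : Node L) : Set (Arg L) → Prop
  | and {S : Finset (Elem L)} {φ ψ : Fml L 0} :
      arg S (.and φ ψ) ∈ Γ → OneChild Γ {arg S φ, arg S ψ}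
  | iff {S : Finset (Elem L)} {φ ψ : Fml L 0} :
      arg S (.iff φ ψ) ∈ Γ → OneChild Γ {arg S (.imp φ ψ), arg S (.imp ψ φ)}
  | not_or {S : Finset (Elem L)} {φ ψ : Fml L 0} :
      arg S (.neg (.or φ ψ)) ∈ Γ → OneChild Γ {arg S (.neg φ), arg S (.neg ψ)}
  | not_imp {S : Finset (Elem L)} {φ ψ : Fml L 0} :
      arg S (.neg (.imp φ ψ)) ∈ Γ → OneChild Γ {arg S φ, arg S (.neg ψ)}
  | not_not {S : Finset (Elem L)} {φ : Fml L 0} :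
      arg S (.neg (.neg φ)) ∈ Γ → OneChild Γ {arg S φ}
  | close {S S' : Finset (Elem L)} {φ : Fml L 0} :
      arg S φ ∈ Γ → arg S' (.neg φ) ∈ Γ → OneChild Γ {arg (S ∪ S') .bot}
  | all {S : Finset (Elem L)} {φ : Fml L 1} {t : L.Term ℕ} :
      arg S (.all φ) ∈ Γ → Admissible t Γ → OneChild Γ {arg S (φ.inst1 t)}
  | ex {S : Finset (Elem L)} {φ : Fml L 1} {c : ℕ} :
      arg S (.ex φ) ∈ Γ → Fresh c Γ → OneChild Γ {arg S (φ.inst1 (.var c))}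
  | not_all {S : Finset (Elem L)} {φ : Fml L 1} {c : ℕ} :
      arg S (.neg (.all φ)) ∈ Γ → Fresh c Γ → OneChild Γ {arg S (.neg (φ.inst1 (.var c)))}
  | not_ex {S : Finset (Elem L)} {φ : Fml L 1} {t : L.Term ℕ} :
      arg S (.neg (.ex φ)) ∈ Γ → Admissible t Γ → OneChild Γ {arg S (.neg (φ.inst1 t))}

/-- The rewriting rules with two children: `Branches χ φ ψ` if `(S, χ)` is rewritten into
`(S, φ) | (S, ψ)`. -/
inductive Branches : Fml L 0 → Fml L 0 → Fml L 0 → Prop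
  | or (φ ψ : Fml L 0) : Branches (.or φ ψ) φ ψ
  | imp (φ ψ : Fml L 0) : Branches (.imp φ ψ) (.neg φ) ψ
  | not_and (φ ψ : Fml L 0) : Branches (.neg (.and φ ψ)) (.neg φ) (.neg ψ)
  | not_iff (φ ψ : Fml L 0) :
      Branches (.neg (.iff φ ψ)) (.neg (.imp φ ψ)) (.neg (.imp ψ φ))

/-! ### Tableaux

A `Tree` records the steps of a finite tableau; together with its root it determines all nodes. -/

inductive Tree (L : FirstOrder.Language.{u, v}) : Type (max u v)
  /-- no step -/
  | leaf
  /-- a rewriting step with one child, which gets the additional arguments `N` -/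
  | extend (N : Set (Arg L)) (T : Tree L)
  /-- `(S, χ)` is rewritten into `(S, φ) | (S, ψ)` -/
  | split (S : Finset (Elem L)) (χ φ ψ : Fml L 0) (T₁ T₂ : Tree L)
  /-- a defeasible rule `ρ` with support `S` for its antecedent is applied; `aux` is the tableau
  which establishes `S` and which starts from the node with the negated antecedent as a test -/
  | apply (S : Finset (Elem L)) (ρ : Rule L 0) (aux T : Tree L)

/-- The test `({¬φ?}, ¬φ)` for a proposition `φ`. -/
def testArg (φ : Fml L 0) : Arg L := arg {Elem.test (.neg φ)} (.neg φ)

/-- `T.IsClosure Γ S`: with root `Γ`, every leaf `Λᵢ` of `T` contains some `(Sᵢ, ⊥)`, and `S` is the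
union of such `Sᵢ`; that is, `S` is a support for the closure of the tableau. -/
def Tree.IsClosure : Tree L → Node L → Finset (Elem L) → Prop
  | .leaf, Γ, S => arg S .bot ∈ Γ
  | .extend N T, Γ, S => T.IsClosure (Γ ∪ N) S
  | .split S₀ _ φ ψ T₁ T₂, Γ, S => ∃ S₁ S₂ : Finset (Elem L),
      T₁.IsClosure (insert (arg S₀ φ) Γ) S₁ ∧ T₂.IsClosure (insert (arg S₀ ψ) Γ) S₂ ∧
        S = S₁ ∪ S₂
  | .apply S₀ ρ _ T, Γ, S => T.IsClosure (insert ({Elem.rule S₀ ρ}, ρ.cons) Γ) S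

/-- `T.IsTableau D Γ`: the tree is an argumentation tableau with root `Γ` for the rules `D`.  A ground
instance `φ ⤳ ψ` of a rule may be applied in a node if the node, extended with the test for `φ`, has a
tableau whose closure has a support consisting of this test and a set `S` without tests; then
`({(S, φ ⤳ ψ)}, ψ)` is added. -/
def Tree.IsTableau (D : Set (Σ n, Rule L n)) : Tree L → Node L → Prop
  | .leaf, _ => True
  | .extend N T, Γ => OneChild Γ N ∧ T.IsTableau D (Γ ∪ N)
  | .split S χ φ ψ T₁ T₂, Γ => arg S χ ∈ Γ ∧ Branches χ φ ψ ∧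
      T₁.IsTableau D (insert (arg S φ) Γ) ∧ T₂.IsTableau D (insert (arg S ψ) Γ)
  | .apply S ρ aux T, Γ => ρ ∈ groundInstances D ∧
      aux.IsTableau D (insert (testArg ρ.ante) Γ) ∧
      aux.IsClosure (insert (testArg ρ.ante) Γ) (insert (Elem.test (.neg ρ.ante)) S) ∧
      (∀ e ∈ S, ∀ φ, e ≠ Elem.test φ) ∧
      T.IsTableau D (insert ({Elem.rule S ρ}, ρ.cons) Γ)

/-- The root `{({σ}, σ) | σ ∈ Σ}`. -/
def rootNode (Prem : Set (Fml L 0)) : Node L := {a | ∃ σ ∈ Prem, a = arg {Elem.prem σ} σ}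

/-- `T.Extends T'`: `T'` arises from `T` by further steps at the leaves of `T`. -/
def Tree.Extends : Tree L → Tree L → Prop
  | .leaf, _ => True
  | .extend N T, T' => ∃ U, T' = .extend N U ∧ T.Extends U
  | .split S χ φ ψ T₁ T₂, T' =>
      ∃ U₁ U₂, T' = .split S χ φ ψ U₁ U₂ ∧ T₁.Extends U₁ ∧ T₂.Extends U₂
  | .apply S ρ aux T, T' => ∃ U, T' = .apply S ρ aux U ∧ T.Extends U

/-! ### Local closures and cases -/

/-- The supports `S` of the arguments `(S, ⊥)` in the root `Γ` of `T` after the supports for leaf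
closures have been propagated towards the root. -/
def Tree.localClosures : Tree L → Node L → Set (Finset (Elem L))
  | .leaf, Γ => {S | arg S .bot ∈ Γ}
  | .extend N T, Γ => {S | arg S .bot ∈ Γ} ∪ T.localClosures (Γ ∪ N)
  | .split S₀ _ φ ψ T₁ T₂, Γ =>
      {S | arg S .bot ∈ Γ} ∪
      {S | ∃ S₁ ∈ T₁.localClosures (insert (arg S₀ φ) Γ),
        ∃ S₂ ∈ T₂.localClosures (insert (arg S₀ ψ) Γ),
          S₀ ⊆ S₁ ∧ S₀ ⊆ S₂ ∧ S = S₁ ∪ S₂} ∪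
      {S | (S ∈ T₁.localClosures (insert (arg S₀ φ) Γ) ∨
        S ∈ T₂.localClosures (insert (arg S₀ ψ) Γ)) ∧ ¬ S₀ ⊆ S}
  | .apply S₀ ρ _ T, Γ =>
      {S | arg S .bot ∈ Γ} ∪ T.localClosures (insert ({Elem.rule S₀ ρ}, ρ.cons) Γ)

/-- `T.IsCase Γ S`: the supporting elements `S` hold together in a case described by the tableau `T`
with root `Γ`.  A case results from eliminating alternatives: where an argument whose support is not
within `S` has been split, one alternative is chosen.  The alternatives of an argument that is
supported by `S` itself are not eliminated, they are sub-cases of the case.  In every branch that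
remains, each element of `S` must be available: `({σ}, σ)` for a premise and `({(S', η ⤳ μ)}, μ)`
for an applied rule. -/
def Tree.IsCase : Tree L → Node L → Finset (Elem L) → Prop
  | .leaf, Γ, S => ∀ e ∈ S, ({e}, e.hat) ∈ Γ
  | .extend N T, Γ, S => T.IsCase (Γ ∪ N) S
  | .split S₀ _ φ ψ T₁ T₂, Γ, S =>
      (S₀ ⊆ S ∧ T₁.IsCase (insert (arg S₀ φ) Γ) S ∧ T₂.IsCase (insert (arg S₀ ψ) Γ) S) ∨
      (¬ S₀ ⊆ S ∧ (T₁.IsCase (insert (arg S₀ φ) Γ) S ∨ T₂.IsCase (insert (arg S₀ ψ) Γ) S))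
  | .apply S₀ ρ _ T, Γ, S => T.IsCase (insert ({Elem.rule S₀ ρ}, ρ.cons) Γ) S

/-- The set of propositions `Ŝ` of a set `S` of supporting elements. -/
def hatSet (S : Finset (Elem L)) : Set (Fml L 0) := {φ | ∃ e ∈ S, e.hat = .prop φ}

/-- `S` is a minimal inconsistent case of the tableau `T` with root `Γ`: it is a case, `Ŝ` is
inconsistent, and no proper subset of `S` is inconsistent. -/
structure IsMinimalInconsistentCase (T : Tree L) (Γ : Node L) (S : Finset (Elem L)) : Prop where
  isCase : T.IsCase Γ S
  inconsistent : ¬ Consistent (hatSet S)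
  minimal : ∀ S' : Finset (Elem L), S' ⊂ S → Consistent (hatSet S')

end ArgTableau

/-!
A leaf that remains in the case contains `({e}, ê)` for every `e ∈ S`, and the propositions among
the `ê` are inconsistent. By completeness of the rewriting rules, the tableau can be continued from
this leaf until it closes locally; no further rules need to be applied. What has to be controlled is
the support of the local closure. It has to be all of `S`, and only then can it be propagated to
the root: where an argument supported by `S` was split, both children have `S` as a support, and
where some other argument was split, `S` is inherited from the child that was kept
(`Tree.exists_extends_mem_localClosures`).

The support is controlled by proving soundness together with completeness. A set `Γ` of arguments
is locally closable at a node `Λ ⊇ Γ` if some tableau for `Λ` has a local closure with a support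
`S' ⊆ S` such that the propositions supported in `Γ` by subsets of `S'` are inconsistent. The
restriction to `Γ` is essential: the leaf also contains alternatives of split arguments, which do
not follow from the propositions of `S`. For `Γ` the set of all `({e}, ê)`, `e ∈ S`, local
closability gives a support `S' ⊆ S` with inconsistent propositions, so `S' = S` by minimality
(`exists_mem_localClosures`).

If a finite set of arguments is not locally closable, then it can be enlarged, without becoming
locally closable, so as to meet each demand of the rewriting rules: in one of the two branches of a
split (`LocallyOpen.split`), with a new constant as a witness of an existential claim
(`LocallyOpen.extend_witness`), and with any ground term that occurs for a universal claim. At each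
stage finitely many demands arise, so that all of them can be met before the next stage, whatever
the cardinality of the language. The union of the stages supports a Hintikka set, which has a
model whose domain consists of the ground terms that occur in it (`IsHintikka.consistent`). Since
universal claims are instantiated only with terms that occur, the function symbols are interpreted
arbitrarily where they lead to terms that do not. New constants are always available, as each
argument mentions finitely many constants (`Elem.finite_mentions`).
-/

namespace ArgTableau

open FirstOrder FirstOrder.Language

variable {L : FirstOrder.Language.{u, v}}

/-! ### Substitution and truth -/

theorem Fml.realize_subst {M : Type*} [L.Structure M] (e : ℕ → M) {n : ℕ} (φ : Fml L n) :
    ∀ {m : ℕ} (s : Fin n → L.Term (ℕ ⊕ Fin m)) (x : Fin m → M),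
      (φ.subst s).Realize e x ↔ φ.Realize e fun i => (s i).realize (Sum.elim e x) := by
  -- lifting a substitution under a quantifier agrees with appending a value to the assignment
  have lift {n m : ℕ} (s : Fin n → L.Term (ℕ ⊕ Fin m)) (x : Fin m → M) (a : M) :
      (fun i => (liftSubst s i).realize (Sum.elim e (Fin.snoc x a : Fin (m + 1) → M))) =
        (Fin.snoc (fun i => (s i).realize (Sum.elim e x)) a : Fin (n + 1) → M) := by
    funext i
    refine Fin.lastCases ?_ (fun j => ?_) i
    · simp [liftSubst]
    · simp only [liftSubst, Fin.snoc_castSucc, Term.realize_relabel]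
      congr 1
      funext k
      rcases k with k | k <;> simp
  induction φ with
  | rel R ts =>
    intro m s x
    simp only [Fml.subst, Fml.Realize, Term.realize_subst]
    refine iff_of_eq (congrArg _ (funext fun i => congrArg (fun v => (ts i).realize v) ?_))
    funext k
    rcases k with k | k <;> rfl
  | bot => intros; rfl
  | neg φ ih => intro m s x; simp only [Fml.subst, Fml.Realize, ih]
  | and φ ψ ih ih' => intro m s x; simp only [Fml.subst, Fml.Realize, ih, ih']
  | or φ ψ ih ih' => intro m s x; simp only [Fml.subst, Fml.Realize, ih, ih']
  | imp φ ψ ih ih' => intro m s x; simp only [Fml.subst, Fml.Realize, ih, ih']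
  | iff φ ψ ih ih' => intro m s x; simp only [Fml.subst, Fml.Realize, ih, ih']
  | all φ ih => intro m s x; simp only [Fml.subst, Fml.Realize, ih, lift]
  | ex φ ih => intro m s x; simp only [Fml.subst, Fml.Realize, ih, lift]

theorem Fml.realize_inst1 {M : Type*} [L.Structure M] (e : ℕ → M) (φ : Fml L 1) (t : L.Term ℕ) :
    (φ.inst1 t).Realize e Fin.elim0 ↔ φ.Realize e (Fin.snoc Fin.elim0 (t.realize e)) := by
  rw [Fml.inst1, Fml.inst, Fml.realize_subst]
  have h : (fun _ : Fin 1 => (t.relabel Sum.inl).realize (Sum.elim e Fin.elim0)) =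
      (Fin.snoc Fin.elim0 (t.realize e) : Fin 1 → M) := by
    funext i
    rw [Fin.fin_one_eq_zero i, Term.realize_relabel, Sum.elim_comp_inl]
    rfl
  rw [h]

/-- The number of connectives and quantifiers of a formula. A biconditional counts double, since it
is rewritten into implications. -/
def Fml.size : {n : ℕ} → Fml L n → ℕ
  | _, .rel _ _ => 0
  | _, .bot => 0
  | _, .neg φ => φ.size + 1
  | _, .and φ ψ => φ.size + ψ.size + 1
  | _, .or φ ψ => φ.size + ψ.size + 1
  | _, .imp φ ψ => φ.size + ψ.size + 1
  | _, .iff φ ψ => φ.size + ψ.size + 2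
  | _, .all φ => φ.size + 1
  | _, .ex φ => φ.size + 1

theorem Fml.size_subst {n : ℕ} (φ : Fml L n) :
    ∀ {m : ℕ} (s : Fin n → L.Term (ℕ ⊕ Fin m)), (φ.subst s).size = φ.size := by
  induction φ <;> intros <;> simp_all [Fml.subst, Fml.size]

theorem Fml.size_inst1 (φ : Fml L 1) (t : L.Term ℕ) : (φ.inst1 t).size = φ.size :=
  φ.size_subst _

/-! ### Occurrences of ground terms -/

theorem IsSubterm.refl {α : Type} (t : L.Term α) : IsSubterm t t := by
  cases t <;> simp [IsSubterm]

theorem IsSubterm.trans {α : Type} {r s t : L.Term α} (h : IsSubterm r s) (h' : IsSubterm s t) :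
    IsSubterm r t := by
  induction t with
  | var a => rw [IsSubterm] at h'; exact h' ▸ h
  | func f ts ih =>
    rw [IsSubterm] at h'
    rcases h' with rfl | ⟨i, hi⟩
    · exact h
    · exact Or.inr ⟨i, ih i hi⟩

theorem finite_isSubterm {α : Type} (t : L.Term α) : {s | IsSubterm s t}.Finite := by
  induction t with
  | var a => exact Set.finite_singleton _
  | func f ts ih =>
    refine ((Set.finite_singleton (Term.func f ts)).union (Set.finite_iUnion ih)).subset ?_
    rintro s (hs | ⟨i, hi⟩)
    · exact Or.inl hs
    · exact Or.inr (Set.mem_iUnion.2 ⟨i, hi⟩)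

theorem relabel_inl_injective {n : ℕ} :
    Function.Injective fun s : L.Term ℕ => (s.relabel Sum.inl : L.Term (ℕ ⊕ Fin n)) := by
  refine Function.LeftInverse.injective
    (g := fun t => t.relabel (Sum.elim id fun _ => 0)) fun s => ?_
  simp only [Term.relabel_relabel, Sum.elim_comp_inl, Term.relabel_id]

theorem exists_relabel_inl_eq (t : L.Term (ℕ ⊕ Fin 0)) :
    ∃ s : L.Term ℕ, s.relabel Sum.inl = t := by
  refine ⟨t.relabel (Sum.elim id Fin.elim0), ?_⟩
  rw [Term.relabel_relabel]
  convert Term.relabel_id t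
  funext k
  rcases k with k | k
  · rfl
  · exact k.elim0

theorem Fml.finite_occurs {n : ℕ} (φ : Fml L n) : {s | φ.Occurs s}.Finite := by
  induction φ with
  | rel R ts =>
    have h : (⋃ i, {s : L.Term ℕ | IsSubterm (s.relabel Sum.inl) (ts i)}).Finite :=
      Set.finite_iUnion fun i =>
        (finite_isSubterm (ts i)).preimage relabel_inl_injective.injOn
    refine h.subset ?_
    rintro s ⟨i, hi⟩
    exact Set.mem_iUnion.2 ⟨i, hi⟩
  | bot => exact Set.finite_empty
  | neg φ ih => exact ih
  | and φ ψ ih ih' => exact ih.union ih'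
  | or φ ψ ih ih' => exact ih.union ih'
  | imp φ ψ ih ih' => exact ih.union ih'
  | iff φ ψ ih ih' => exact ih.union ih'
  | all φ ih => exact ih
  | ex φ ih => exact ih

theorem Claim.finite_occurs {n : ℕ} (χ : Claim L n) : {s | χ.Occurs s}.Finite := by
  cases χ with
  | prop φ => exact φ.finite_occurs
  | undercut η μ => exact η.finite_occurs.union μ.finite_occurs

theorem Fml.Occurs.of_isSubterm {n : ℕ} {φ : Fml L n} {s t : L.Term ℕ} (h : φ.Occurs t)
    (hst : IsSubterm s t) : φ.Occurs s := by
  have relabel {k : ℕ} {s t : L.Term ℕ} (hst : IsSubterm s t) :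
      IsSubterm (s.relabel Sum.inl : L.Term (ℕ ⊕ Fin k)) (t.relabel Sum.inl) := by
    induction t with
    | var a => rw [IsSubterm] at hst; rw [hst]; exact IsSubterm.refl _
    | func f ts ih =>
      rw [IsSubterm] at hst
      rcases hst with rfl | ⟨i, hi⟩
      · exact IsSubterm.refl _
      · exact Or.inr ⟨i, ih i hi⟩
  induction φ with
  | rel R ts => obtain ⟨i, hi⟩ := h; exact ⟨i, (relabel hst).trans hi⟩
  | bot => exact h
  | neg φ ih => exact ih h
  | and φ ψ ih ih' => exact h.imp ih ih'
  | or φ ψ ih ih' => exact h.imp ih ih'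
  | imp φ ψ ih ih' => exact h.imp ih ih'
  | iff φ ψ ih ih' => exact h.imp ih ih'
  | all φ ih => exact ih h
  | ex φ ih => exact ih h

/-- The truth value of a formula does not depend on the value of a constant that does not occur
in it. -/
theorem Fml.realize_update {M : Type*} [L.Structure M] (e : ℕ → M) (c : ℕ) (a : M) {n : ℕ}
    {φ : Fml L n} (h : ¬ φ.Occurs (.var c)) (x : Fin n → M) :
    φ.Realize (Function.update e c a) x ↔ φ.Realize e x := by
  have term {n : ℕ} (x : Fin n → M) (t : L.Term (ℕ ⊕ Fin n))
      (h : ¬ IsSubterm ((Term.var c : L.Term ℕ).relabel Sum.inl) t) :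
      t.realize (Sum.elim (Function.update e c a) x) = t.realize (Sum.elim e x) := by
    induction t with
    | var k =>
      rcases k with k | k
      · have : k ≠ c := by rintro rfl; exact h rfl
        exact Function.update_of_ne this _ _
      · rfl
    | func f ts ih =>
      simp only [Term.realize_func]
      exact congrArg _ (funext fun i => ih i fun hi => h (Or.inr ⟨i, hi⟩))
  induction φ with
  | rel R ts =>
    simp only [Fml.Realize]
    exact iff_of_eq (congrArg _ (funext fun i => term x _ fun hi => h ⟨i, hi⟩))
  | bot => rfl
  | neg φ ih => simp only [Fml.Realize, ih h]
  | and φ ψ ih ih' =>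
    simp only [Fml.Realize, ih fun k => h (Or.inl k), ih' fun k => h (Or.inr k)]
  | or φ ψ ih ih' =>
    simp only [Fml.Realize, ih fun k => h (Or.inl k), ih' fun k => h (Or.inr k)]
  | imp φ ψ ih ih' =>
    simp only [Fml.Realize, ih fun k => h (Or.inl k), ih' fun k => h (Or.inr k)]
  | iff φ ψ ih ih' =>
    simp only [Fml.Realize, ih fun k => h (Or.inl k), ih' fun k => h (Or.inr k)]
  | all φ ih => simp only [Fml.Realize, ih h]
  | ex φ ih => simp only [Fml.Realize, ih h]

/-! ### Hintikka sets -/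

/-- The set `H` contains the formulas into which `χ` is rewritten; of a branching formula, those of
one alternative. A universal claim is to be instantiated with the term `o`, or with some term if
`o` is `none`. -/
def Reduced (H : Set (Fml L 0)) (o : Option (L.Term ℕ)) : Fml L 0 → Prop
  | .and φ ψ => φ ∈ H ∧ ψ ∈ H
  | .or φ ψ => φ ∈ H ∨ ψ ∈ H
  | .imp φ ψ => .neg φ ∈ H ∨ ψ ∈ H
  | .iff φ ψ => .imp φ ψ ∈ H ∧ .imp ψ φ ∈ H
  | .all φ => ∃ t, (∀ s ∈ o, t = s) ∧ φ.inst1 t ∈ H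
  | .ex φ => ∃ t, φ.inst1 t ∈ H
  | .neg (.neg φ) => φ ∈ H
  | .neg (.and φ ψ) => .neg φ ∈ H ∨ .neg ψ ∈ H
  | .neg (.or φ ψ) => .neg φ ∈ H ∧ .neg ψ ∈ H
  | .neg (.imp φ ψ) => φ ∈ H ∧ .neg ψ ∈ H
  | .neg (.iff φ ψ) => .neg (.imp φ ψ) ∈ H ∨ .neg (.imp ψ φ) ∈ H
  | .neg (.all φ) => ∃ t, .neg (φ.inst1 t) ∈ H
  | .neg (.ex φ) => ∃ t, (∀ s ∈ o, t = s) ∧ .neg (φ.inst1 t) ∈ H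
  | _ => True

theorem Reduced.mono {H H' : Set (Fml L 0)} (hH : H ⊆ H') {o : Option (L.Term ℕ)} {χ : Fml L 0}
    (h : Reduced H o χ) : Reduced H' o χ := by
  unfold Reduced at h ⊢
  split at h
  case h_1 | h_4 | h_9 | h_10 => exact h.imp (@hH _) (@hH _)
  case h_2 | h_3 | h_8 | h_11 => exact h.imp (@hH _) (@hH _)
  case h_5 | h_13 => exact h.imp fun t ht => ht.imp_right (@hH _)
  case h_6 | h_12 => exact h.imp fun t ht => hH ht
  case h_7 => exact hH h
  case h_14 => simp_all

/-- A Hintikka set: free of clashes and closed under the rewriting rules, where universal claims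
are instantiated with all ground terms that occur in the set, and with at least one term. -/
structure IsHintikka (H : Set (Fml L 0)) : Prop where
  bot : .bot ∉ H
  clash : ∀ φ, φ ∈ H → .neg φ ∉ H
  reduced : ∀ χ ∈ H, ∀ o : Option (L.Term ℕ), (∀ t ∈ o, ∃ φ ∈ H, φ.Occurs t) → Reduced H o χ

/-- The domain of the term model of `H`: the ground terms that occur in `H`, or a single term if
there are none. -/
def termDomain (H : Set (Fml L 0)) : Set (L.Term ℕ) :=
  {t | (∃ φ ∈ H, φ.Occurs t) ∨ ((∀ s : L.Term ℕ, ¬ ∃ φ ∈ H, φ.Occurs s) ∧ t = .var 0)}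

/-- The term model of `H`, lifted to the universe in which `Consistent` asks for models. -/
def TermModel (H : Set (Fml L 0)) : Type (max u v) := ULift.{v} (termDomain H)

instance (H : Set (Fml L 0)) : Nonempty (TermModel H) := by
  by_cases h : ∃ s : L.Term ℕ, ∃ φ ∈ H, φ.Occurs s
  · exact ⟨⟨⟨h.choose, Or.inl h.choose_spec⟩⟩⟩
  · exact ⟨⟨⟨.var 0, Or.inr ⟨fun s hs => h ⟨s, hs⟩, rfl⟩⟩⟩⟩

open Classical in
/-- The element of the term model denoted by a ground term; the terms outside the domain denote
an arbitrary element. -/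
noncomputable def TermModel.of (H : Set (Fml L 0)) (t : L.Term ℕ) : TermModel H :=
  if h : t ∈ termDomain H then ⟨⟨t, h⟩⟩ else Classical.arbitrary _

theorem TermModel.of_val {H : Set (Fml L 0)} {t : L.Term ℕ} (h : ∃ φ ∈ H, φ.Occurs t) :
    (TermModel.of H t).down.1 = t := by
  have h' : t ∈ termDomain H := Or.inl h
  simp [TermModel.of, h']

theorem TermModel.of_down {H : Set (Fml L 0)} (a : TermModel H) :
    TermModel.of H a.down.1 = a := by
  have h' : a.down.1 ∈ termDomain H := a.down.2
  exact dif_pos h'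

noncomputable instance (H : Set (Fml L 0)) : L.Structure (TermModel H) where
  funMap f x := TermModel.of H (.func f fun i => (x i).down.1)
  RelMap R x := .rel R (fun i => (x i).down.1.relabel Sum.inl) ∈ H

theorem TermModel.realize_term {H : Set (Fml L 0)} {t : L.Term ℕ} (h : ∃ φ ∈ H, φ.Occurs t) :
    t.realize (fun c => TermModel.of H (.var c)) = TermModel.of H t := by
  induction t with
  | var c => rfl
  | func f ts ih =>
    have hi (i) : ∃ φ ∈ H, φ.Occurs (ts i) := by
      obtain ⟨φ, hφ, ho⟩ := h
      exact ⟨φ, hφ, ho.of_isSubterm (Or.inr ⟨i, IsSubterm.refl _⟩)⟩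
    rw [Term.realize_func]
    simp only [ih _ (hi _)]
    change TermModel.of H _ = _
    simp only [TermModel.of_val (hi _)]

theorem TermModel.realize_rel {H : Set (Fml L 0)} {k : ℕ} (R : L.Relations k)
    (ts : Fin k → L.Term (ℕ ⊕ Fin 0))
    (h : ∃ φ ∈ H, ∀ t, (Fml.rel R ts : Fml L 0).Occurs t → φ.Occurs t) :
    (Fml.rel R ts).Realize (fun c => TermModel.of H (.var c)) Fin.elim0 ↔ .rel R ts ∈ H := by
  obtain ⟨φ, hφ, ho⟩ := h
  choose g hg using fun i => exists_relabel_inl_eq (ts i)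
  have hi (i) : ∃ φ ∈ H, φ.Occurs (g i) :=
    ⟨φ, hφ, ho _ ⟨i, by rw [hg]; exact IsSubterm.refl _⟩⟩
  obtain rfl : (fun i => (g i).relabel Sum.inl) = ts := funext hg
  rw [Fml.Realize]
  simp only [Term.realize_relabel, Sum.elim_comp_inl, TermModel.realize_term (hi _)]
  change (.rel R (fun i => (TermModel.of H (g i)).down.1.relabel Sum.inl) ∈ H) ↔ _
  simp only [TermModel.of_val (hi _)]

/-- Every element of the term model is denoted by a term with which the universal claims of a
Hintikka set are instantiated. -/
theorem IsHintikka.exists_realize_eq {H : Set (Fml L 0)} (hH : IsHintikka H) {χ : Fml L 0}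
    (hχ : χ ∈ H) (a : TermModel H) {P : L.Term ℕ → Prop}
    (hP : ∀ o, Reduced H o χ → ∃ t, (∀ s ∈ o, t = s) ∧ P t) :
    ∃ t, P t ∧ t.realize (fun c => TermModel.of H (.var c)) = a := by
  by_cases h : ∃ φ ∈ H, φ.Occurs a.down.1
  · obtain ⟨t, ht, hPt⟩ := hP (some a.down.1)
      (hH.reduced χ hχ _ fun s hs => by cases hs; exact h)
    obtain rfl := ht _ rfl
    exact ⟨_, hPt, by rw [TermModel.realize_term h, TermModel.of_down]⟩
  · -- no ground term occurs in `H`, so the term model has only one element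
    obtain ⟨t, -, hPt⟩ := hP none (hH.reduced χ hχ _ fun s hs => by cases hs)
    refine ⟨t, hPt, ?_⟩
    obtain ⟨hn, ha⟩ := a.down.2.resolve_left h
    refine ULift.ext _ _ (Subtype.ext ?_)
    rw [ha]
    exact ((Term.realize _ t : TermModel H).down.2.resolve_left (hn _)).2

/-- The truth lemma for the term model, by induction on the size of the formula. -/
theorem IsHintikka.realize {H : Set (Fml L 0)} (hH : IsHintikka H) (k : ℕ) :
    ∀ φ : Fml L 0, φ.size < k →
      (φ ∈ H → φ.Realize (fun c => TermModel.of H (.var c)) Fin.elim0) ∧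
      (.neg φ ∈ H → ¬ φ.Realize (fun c => TermModel.of H (.var c)) Fin.elim0) := by
  induction k with
  | zero => intro φ h; omega
  | succ k ih =>
    intro φ hk
    have pos {ψ : Fml L 0} (h : ψ ∈ H)
        (hψ : ψ.size < k := by simp only [Fml.size, Fml.size_inst1] at *; omega) := (ih ψ hψ).1 h
    have neg {ψ : Fml L 0} (h : .neg ψ ∈ H)
        (hψ : ψ.size < k := by simp only [Fml.size, Fml.size_inst1] at *; omega) := (ih ψ hψ).2 h
    have red {χ : Fml L 0} (h : χ ∈ H) : Reduced H none χ :=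
      hH.reduced χ h none fun s hs => by cases hs
    cases φ with
    | rel R ts =>
      refine ⟨fun h => (TermModel.realize_rel R ts ⟨_, h, fun _ => id⟩).2 h, fun h h' => ?_⟩
      exact hH.clash _ ((TermModel.realize_rel R ts ⟨_, h, fun _ => id⟩).1 h') h
    | bot => exact ⟨fun h => hH.bot h, fun _ h => h⟩
    | neg φ => exact ⟨fun h => neg h, fun h h' => h' (pos (red h))⟩
    | and φ ψ =>
      exact ⟨fun h => ⟨pos (red h).1, pos (red h).2⟩, fun h h' =>
        (red h).elim (fun g => (neg g) h'.1) fun g => (neg g) h'.2⟩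
    | or φ ψ =>
      exact ⟨fun h => (red h).imp (fun g => pos g) fun g => pos g, fun h h' =>
        h'.elim (neg (red h).1) (neg (red h).2)⟩
    | imp φ ψ =>
      exact ⟨fun h h' => (red h).elim (fun g => absurd h' (neg g)) fun g => pos g,
        fun h h' => (neg (red h).2) (h' (pos (red h).1))⟩
    | iff φ ψ =>
      exact ⟨fun h => ⟨pos (red h).1, pos (red h).2⟩, fun h h' =>
        (red h).elim (fun g => (neg g) h'.1) fun g => (neg g) h'.2⟩
    | all φ =>
      refine ⟨fun h a => ?_, fun h h' => ?_⟩
      · obtain ⟨t, ht, rfl⟩ := hH.exists_realize_eq h a fun _ h => h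
        exact (Fml.realize_inst1 _ φ t).1 (pos ht)
      · obtain ⟨t, ht⟩ := red h
        exact (neg ht) ((Fml.realize_inst1 _ φ t).2 (h' _))
    | ex φ =>
      refine ⟨fun h => ?_, fun h h' => ?_⟩
      · obtain ⟨t, ht⟩ := red h
        exact ⟨_, (Fml.realize_inst1 _ φ t).1 (pos ht)⟩
      · obtain ⟨a, ha⟩ := h'
        obtain ⟨t, ht, rfl⟩ := hH.exists_realize_eq h a fun _ h => h
        exact (neg ht) ((Fml.realize_inst1 _ φ t).2 ha)

theorem IsHintikka.consistent {H : Set (Fml L 0)} (hH : IsHintikka H) : Consistent H :=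
  ⟨TermModel H, inferInstance, inferInstance, fun c => TermModel.of H (.var c),
    fun φ hφ => (hH.realize _ φ (Nat.lt_succ_self _)).1 hφ⟩

/-! ### New constants -/

/-- The supporting element that is represented by a tree. -/
def Elem.mk (a : PreElem L) : Elem L := Quotient.mk (PreElem.setoid L) a

theorem Elem.rule_toFinset_map_mk (S : List (PreElem L)) (ρ : Rule L 0) :
    Elem.rule (S.map Elem.mk).toFinset ρ = Elem.mk (.rule S ρ) := by
  have mem_elem (e : Elem L) : e ∈ (S.map Elem.mk).toFinset.toList ↔ ∃ a ∈ S, Elem.mk a = e := by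
    simp
  have mem (b : PreElem L) : b ∈ (S.map Elem.mk).toFinset.toList.map Quotient.out ↔
      ∃ a ∈ S, Quotient.out (Elem.mk a) = b := by
    refine List.mem_map.trans ⟨?_, ?_⟩
    · rintro ⟨e, he, rfl⟩
      obtain ⟨a, ha, rfl⟩ := (mem_elem e).1 he
      exact ⟨a, ha, rfl⟩
    · rintro ⟨a, ha, rfl⟩
      exact ⟨Elem.mk a, (mem_elem _).2 ⟨a, ha, rfl⟩, rfl⟩
  choose! f hf hf' using fun b => (mem b).1
  refine Quotient.sound (PreElem.Equiv.rule f (fun a => Quotient.out (Elem.mk a)) hf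
    (fun b hb => ?_) (fun a ha => (mem _).2 ⟨a, ha, rfl⟩) fun a _ => Quotient.mk_out a)
  have h : Quotient.out (Elem.mk (f b)) ≈ f b := Quotient.mk_out (f b)
  rwa [hf' b hb] at h

theorem Elem.induction {P : Elem L → Prop} (prem : ∀ σ, P (Elem.prem σ))
    (test : ∀ φ, P (Elem.test φ)) (rule : ∀ S ρ, (∀ e ∈ S, P e) → P (Elem.rule S ρ)) (e : Elem L) :
    P e := by
  have pre (a : PreElem L) : P (Elem.mk a) := by
    induction a using PreElem.rec (motive_2 := fun S => ∀ a ∈ S, P (Elem.mk a)) with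
    | prem σ => exact prem σ
    | test φ => exact test φ
    | rule S ρ ih =>
      rw [← Elem.rule_toFinset_map_mk]
      refine rule _ _ fun e he => ?_
      obtain ⟨a, ha, rfl⟩ := List.mem_map.1 (List.mem_toFinset.1 he)
      exact ih a ha
    | nil => rename_i h; cases h
    | cons a S ih ih' =>
      rename_i b hb
      rcases List.mem_cons.1 hb with rfl | hb
      · exact ih
      · exact ih' _ hb
  exact Quotient.ind pre e

theorem Elem.mentions_prem_iff {c : ℕ} {σ : Fml L 0} :
    (Elem.prem σ).Mentions c ↔ σ.Occurs (.var c) := by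
  refine ⟨fun h => ?_, .prem⟩
  generalize he : Elem.prem σ = e at h
  cases h with
  | prem h => rwa [Elem.prem_injective he]
  | test h => exact absurd he (Elem.prem_ne_test _ _)
  | ante h | cons h | supp h => exact absurd he (Elem.prem_ne_rule _ _ _)

theorem Elem.mentions_test_iff {c : ℕ} {φ : Fml L 0} :
    (Elem.test φ).Mentions c ↔ φ.Occurs (.var c) := by
  refine ⟨fun h => ?_, .test⟩
  generalize he : Elem.test φ = e at h
  cases h with
  | prem h => exact absurd he.symm (Elem.prem_ne_test _ _)
  | test h => rwa [Elem.test_injective he]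
  | ante h | cons h | supp h => exact absurd he (Elem.test_ne_rule _ _ _)

theorem Elem.mentions_rule_iff {c : ℕ} {S : Finset (Elem L)} {ρ : Rule L 0} :
    (Elem.rule S ρ).Mentions c ↔
      ρ.ante.Occurs (.var c) ∨ ρ.cons.Occurs (.var c) ∨ ∃ e ∈ S, e.Mentions c := by
  constructor
  · intro h
    generalize he : Elem.rule S ρ = e at h
    cases h with
    | prem h => exact absurd he.symm (Elem.prem_ne_rule _ _ _)
    | test h => exact absurd he.symm (Elem.test_ne_rule _ _ _)
    | ante h => rw [(Elem.rule_inj.1 he).2]; exact Or.inl h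
    | cons h => rw [(Elem.rule_inj.1 he).2]; exact Or.inr (Or.inl h)
    | supp h h' => rw [(Elem.rule_inj.1 he).1]; exact Or.inr (Or.inr ⟨_, h, h'⟩)
  · rintro (h | h | ⟨e, h, h'⟩)
    · exact .ante h
    · exact .cons h
    · exact .supp h h'

theorem var_injective : Function.Injective (Term.var : ℕ → L.Term ℕ) := fun _ _ h => by
  cases h; rfl

theorem Claim.finite_occurs_var {n : ℕ} (χ : Claim L n) : {c | χ.Occurs (.var c)}.Finite :=
  χ.finite_occurs.preimage var_injective.injOn

theorem Elem.finite_mentions (e : Elem L) : {c | e.Mentions c}.Finite := by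
  induction e using Elem.induction with
  | prem σ => simpa only [mentions_prem_iff, Claim.Occurs] using (Claim.prop σ).finite_occurs_var
  | test φ => simpa only [mentions_test_iff, Claim.Occurs] using (Claim.prop φ).finite_occurs_var
  | rule S ρ ih =>
    refine (((Claim.prop ρ.ante).finite_occurs_var.union ρ.cons.finite_occurs_var).union
      (S.finite_toSet.biUnion ih)).subset fun c hc => ?_
    rcases mentions_rule_iff.1 hc with h | h | ⟨e, he, h⟩
    · exact Or.inl (Or.inl h)
    · exact Or.inl (Or.inr h)
    · exact Or.inr (Set.mem_biUnion he h)

theorem infinite_fresh_union {Γ N : Node L} (hΓ : {c | Fresh c Γ}.Infinite) (hN : N.Finite) :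
    {c | Fresh c (Γ ∪ N)}.Infinite := by
  have h : (⋃ a ∈ N, {c | a.2.Occurs (.var c)} ∪ ⋃ e ∈ a.1, {c | e.Mentions c}).Finite :=
    hN.biUnion fun a _ => a.2.finite_occurs_var.union
      (a.1.finite_toSet.biUnion fun e _ => e.finite_mentions)
  refine (hΓ.sdiff h).mono ?_
  rintro c ⟨hc, hc'⟩ a (ha | ha)
  · exact hc a ha
  · refine ⟨fun ho => hc' (Set.mem_biUnion ha (Or.inl ho)), fun e he hm => ?_⟩
    exact hc' (Set.mem_biUnion ha (Or.inr (Set.mem_biUnion (s := (a.1 : Set (Elem L))) he hm)))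

theorem infinite_fresh_insert {Γ : Node L} (hΓ : {c | Fresh c Γ}.Infinite) (a : Arg L) :
    {c | Fresh c (insert a Γ)}.Infinite := by
  rw [Set.insert_eq, Set.union_comm]
  exact infinite_fresh_union hΓ (Set.finite_singleton a)

theorem exists_admissible {Γ : Node L} (hΓ : {c | Fresh c Γ}.Infinite) :
    ∃ t, Admissible t Γ := by
  by_cases h : ∃ t, TermOccurs t Γ
  · exact h.imp fun t => Or.inl
  · obtain ⟨c, hc⟩ := hΓ.nonempty
    exact ⟨.var c, Or.inr ⟨not_exists.1 h, c, hc, rfl⟩⟩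

theorem OneChild.finite {Γ N : Node L} (h : OneChild Γ N) : N.Finite := by
  cases h <;> simp only [Set.finite_singleton, Set.finite_insert]

/-! ### Locally open sets of arguments -/

/-- The propositions that are supported in `Γ` by subsets of `S`. -/
def supported (Γ : Node L) (S : Finset (Elem L)) : Set (Fml L 0) := {φ | ∃ S' ⊆ S, arg S' φ ∈ Γ}

/-- Some tableau with root `Λ` has a local closure with a support within `S` such that the
propositions that this support has in `Γ` are inconsistent. -/
def LocallyClosable (D : Set (Σ n, Rule L n)) (S : Finset (Elem L)) (Λ Γ : Node L) : Prop :=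
  ∃ S' ⊆ S, ¬ Consistent (supported Γ S') ∧
    ∃ U : Tree L, U.IsTableau D Λ ∧ S' ∈ U.localClosures Λ

/-- `Γ` is a finite set of arguments with supports within `S` whose addition to the node `Λ` does
not lead to a node that is locally closable by means of `Γ`. -/
structure LocallyOpen (D : Set (Σ n, Rule L n)) (S : Finset (Elem L)) (Λ Γ : Node L) : Prop where
  finite : Γ.Finite
  subset : ∀ a ∈ Γ, a.1 ⊆ S
  not_closable : ¬ LocallyClosable D S (Λ ∪ Γ) Γ

/-- Every model of `χ` is a model of `φ`. -/
def Fml.Entails (χ φ : Fml L 0) : Prop :=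
  ∀ (M : Type (max u v)) [Nonempty M] [L.Structure M] (e : ℕ → M),
    χ.Realize e Fin.elim0 → φ.Realize e Fin.elim0

variable {D : Set (Σ n, Rule L n)} {S : Finset (Elem L)} {Λ Γ : Node L}

theorem LocallyOpen.bot_notMem (h : LocallyOpen D S Λ Γ) (S₁ : Finset (Elem L)) :
    arg S₁ .bot ∉ Γ := by
  intro hb
  refine h.not_closable ⟨S₁, h.subset _ hb, ?_, .leaf, trivial, Or.inr hb⟩
  rintro ⟨M, _, _, e, he⟩
  exact he _ ⟨S₁, subset_rfl, hb⟩

/-- One-child steps preserve local openness if what they add to `Γ` is sound for every support. -/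
theorem LocallyOpen.extend (h : LocallyOpen D S Λ Γ) {N : Set (Arg L)}
    (hN : OneChild (Λ ∪ Γ) N) (hS : ∀ a ∈ N, a.1 ⊆ S)
    (sound : ∀ S', Consistent (supported Γ S') → Consistent (supported (Γ ∪ N) S')) :
    LocallyOpen D S Λ (Γ ∪ N) where
  finite := h.finite.union hN.finite
  subset := by
    rintro a (ha | ha)
    · exact h.subset a ha
    · exact hS a ha
  not_closable := by
    rw [← Set.union_assoc]
    rintro ⟨S', hS', hc, U, hU, hm⟩
    exact h.not_closable ⟨S', hS', fun k => hc (sound S' k), .extend N U, ⟨hN, hU⟩, Or.inr hm⟩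

theorem LocallyOpen.extend_of_entails (h : LocallyOpen D S Λ Γ) {S₁ : Finset (Elem L)}
    {χ : Fml L 0} (hχ : arg S₁ χ ∈ Γ) {N : Set (Arg L)} (hN : OneChild (Λ ∪ Γ) N)
    (hNχ : ∀ a ∈ N, ∃ φ, a = arg S₁ φ ∧ χ.Entails φ) :
    LocallyOpen D S Λ (Γ ∪ N) := by
  refine h.extend hN (fun a ha => ?_) ?_
  · obtain ⟨φ, rfl, -⟩ := hNχ a ha
    exact h.subset (arg S₁ χ) hχ
  · rintro S' ⟨M, _, _, e, he⟩
    refine ⟨M, ‹_›, ‹_›, e, ?_⟩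
    rintro φ ⟨S₂, hS₂, hφ | hφ⟩
    · exact he φ ⟨S₂, hS₂, hφ⟩
    · obtain ⟨ψ, hψ, hent⟩ := hNχ _ hφ
      cases hψ
      exact hent M e (he χ ⟨S₁, hS₂, hχ⟩)

theorem LocallyOpen.clash (h : LocallyOpen D S Λ Γ) {S₁ S₂ : Finset (Elem L)} {φ : Fml L 0}
    (h₁ : arg S₁ φ ∈ Γ) : arg S₂ (.neg φ) ∉ Γ := by
  intro h₂
  refine (h.extend (.close (Or.inr h₁) (Or.inr h₂)) ?_ ?_).bot_notMem (S₁ ∪ S₂) (Or.inr rfl)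
  · rintro a rfl
    exact Finset.union_subset (h.subset _ h₁) (h.subset _ h₂)
  · rintro S' ⟨M, _, _, e, he⟩
    refine ⟨M, ‹_›, ‹_›, e, ?_⟩
    rintro ψ ⟨S₃, hS₃, hψ | hψ⟩
    · exact he ψ ⟨S₃, hS₃, hψ⟩
    · cases hψ
      exact absurd (he _ ⟨S₁, Finset.union_subset_left hS₃, h₁⟩)
        (he _ ⟨S₂, Finset.union_subset_right hS₃, h₂⟩)

/-- Existential claims are witnessed by a constant that is new for the whole node, hence new for
the arguments in `Γ`: the value of this constant can be changed in every model. -/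
theorem LocallyOpen.extend_witness (h : LocallyOpen D S Λ Γ) {S₁ : Finset (Elem L)}
    {χ φ : Fml L 0} (hχ : arg S₁ χ ∈ Γ) {c : ℕ} (hc : Fresh c (Λ ∪ Γ))
    (hN : OneChild (Λ ∪ Γ) {arg S₁ φ})
    (hφ : ∀ (M : Type (max u v)) [Nonempty M] [L.Structure M] (e : ℕ → M),
      χ.Realize e Fin.elim0 → ∃ a, φ.Realize (Function.update e c a) Fin.elim0) :
    LocallyOpen D S Λ (Γ ∪ {arg S₁ φ}) := by
  refine h.extend hN (by rintro a rfl; exact h.subset (arg S₁ χ) hχ) ?_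
  rintro S' ⟨M, _, _, e, he⟩
  have old (a : M) : ∀ ψ ∈ supported Γ S', ψ.Realize (Function.update e c a) Fin.elim0 := by
    rintro ψ ⟨S₂, hS₂, hψ⟩
    exact (Fml.realize_update e c a (hc _ (Or.inr hψ)).1 _).2 (he ψ ⟨S₂, hS₂, hψ⟩)
  by_cases hS : S₁ ⊆ S'
  · obtain ⟨a, ha⟩ := hφ M e (he χ ⟨S₁, hS, hχ⟩)
    refine ⟨M, ‹_›, ‹_›, Function.update e c a, ?_⟩
    rintro ψ ⟨S₂, hS₂, hψ | hψ⟩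
    · exact old a ψ ⟨S₂, hS₂, hψ⟩
    · cases hψ; exact ha
  · -- the new argument is not supported by `S'`
    refine ⟨M, ‹_›, ‹_›, e, ?_⟩
    rintro ψ ⟨S₂, hS₂, hψ | hψ⟩
    · exact he ψ ⟨S₂, hS₂, hψ⟩
    · cases hψ; exact absurd hS₂ hS

theorem Branches.realize {χ φ ψ : Fml L 0} (h : Branches χ φ ψ) {M : Type*} [L.Structure M]
    (e : ℕ → M) (x : Fin 0 → M) (hχ : χ.Realize e x) : φ.Realize e x ∨ ψ.Realize e x := by
  cases h <;> simp only [Fml.Realize] at hχ ⊢ <;> tauto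

/-- Splitting an argument preserves local openness in one of the branches. If both branches had
local closures, then so would the tableau: with the union of the two supports if both contain the
support of the argument that is split, and otherwise with one of them, which then does not use
this argument. -/
theorem LocallyOpen.split (h : LocallyOpen D S Λ Γ) {S₁ : Finset (Elem L)} {χ φ ψ : Fml L 0}
    (hχ : arg S₁ χ ∈ Γ) (hb : Branches χ φ ψ) :
    LocallyOpen D S Λ (Γ ∪ {arg S₁ φ}) ∨ LocallyOpen D S Λ (Γ ∪ {arg S₁ ψ}) := by
  have mk (θ : Fml L 0) (hθ : ¬ LocallyClosable D S (insert (arg S₁ θ) (Λ ∪ Γ))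
      (Γ ∪ {arg S₁ θ})) : LocallyOpen D S Λ (Γ ∪ {arg S₁ θ}) := by
    refine ⟨h.finite.union (Set.finite_singleton _), ?_, ?_⟩
    · rintro a (ha | rfl)
      · exact h.subset a ha
      · exact h.subset (arg S₁ χ) hχ
    · rwa [← Set.union_assoc, Set.union_singleton]
  have unused {θ : Fml L 0} {S' : Finset (Elem L)} (hS : ¬ S₁ ⊆ S') :
      supported (Γ ∪ {arg S₁ θ}) S' = supported Γ S' := by
    ext ψ
    constructor
    · rintro ⟨S₂, hS₂, hψ | hψ⟩
      · exact ⟨S₂, hS₂, hψ⟩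
      · cases hψ; exact absurd hS₂ hS
    · rintro ⟨S₂, hS₂, hψ⟩
      exact ⟨S₂, hS₂, Or.inl hψ⟩
  by_contra hcon
  obtain ⟨S₂, hS₂, hc₂, U₂, hU₂, hm₂⟩ := not_not.1 fun k => hcon (Or.inl (mk φ k))
  obtain ⟨S₃, hS₃, hc₃, U₃, hU₃, hm₃⟩ := not_not.1 fun k => hcon (Or.inr (mk ψ k))
  have htab : (Tree.split S₁ χ φ ψ U₂ U₃).IsTableau D (Λ ∪ Γ) := ⟨Or.inr hχ, hb, hU₂, hU₃⟩
  by_cases h₂ : S₁ ⊆ S₂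
  · by_cases h₃ : S₁ ⊆ S₃
    · refine h.not_closable ⟨S₂ ∪ S₃, Finset.union_subset hS₂ hS₃, ?_, _, htab,
        Or.inl (Or.inr ⟨S₂, hm₂, S₃, hm₃, h₂, h₃, rfl⟩)⟩
      rintro ⟨M, _, _, e, he⟩
      rcases hb.realize e _ (he χ ⟨S₁, h₂.trans Finset.subset_union_left, hχ⟩) with hr | hr
      · refine hc₂ ⟨M, ‹_›, ‹_›, e, ?_⟩
        rintro θ ⟨S₄, hS₄, hθ | hθ⟩
        · exact he θ ⟨S₄, hS₄.trans Finset.subset_union_left, hθ⟩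
        · cases hθ; exact hr
      · refine hc₃ ⟨M, ‹_›, ‹_›, e, ?_⟩
        rintro θ ⟨S₄, hS₄, hθ | hθ⟩
        · exact he θ ⟨S₄, hS₄.trans Finset.subset_union_right, hθ⟩
        · cases hθ; exact hr
    · rw [unused h₃] at hc₃
      exact h.not_closable ⟨S₃, hS₃, hc₃, _, htab, Or.inr ⟨Or.inr hm₃, h₃⟩⟩
  · rw [unused h₂] at hc₂
    exact h.not_closable ⟨S₂, hS₂, hc₂, _, htab, Or.inr ⟨Or.inl hm₂, h₂⟩⟩

theorem Reduced.of_mem_arg {Γ' : Node L} {S₁ : Finset (Elem L)} {o : Option (L.Term ℕ)}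
    {χ : Fml L 0} (h : Reduced {φ | arg S₁ φ ∈ Γ'} o χ) (hΓ : Γ' ⊆ Γ) :
    Reduced {φ | arg S₁ φ ∈ Γ} o χ :=
  h.mono fun _ hφ => hΓ hφ

/-- Each demand that a formula supported in `Γ` makes can be met by a locally open extension. -/
theorem LocallyOpen.exists_reduced (hΛ : {c | Fresh c Λ}.Infinite) (h : LocallyOpen D S Λ Γ)
    {S₁ : Finset (Elem L)} {χ : Fml L 0} (hχ : arg S₁ χ ∈ Γ) {o : Option (L.Term ℕ)}
    (ho : ∀ t ∈ o, TermOccurs t Γ) :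
    ∃ Γ', Γ ⊆ Γ' ∧ LocallyOpen D S Λ Γ' ∧ Reduced {φ | arg S₁ φ ∈ Γ'} o χ := by
  have fresh : {c | Fresh c (Λ ∪ Γ)}.Infinite := infinite_fresh_union hΛ h.finite
  obtain ⟨c, hc⟩ := fresh.nonempty
  obtain ⟨t, ht, hto⟩ : ∃ t, Admissible t (Λ ∪ Γ) ∧ ∀ s ∈ o, t = s := by
    cases o with
    | none =>
      obtain ⟨t, ht⟩ := exists_admissible fresh
      exact ⟨t, ht, fun s hs => by cases hs⟩
    | some t =>
      obtain ⟨a, ha, hat⟩ := ho t rfl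
      exact ⟨t, Or.inl ⟨a, Or.inr ha, hat⟩, fun s hs => by cases hs; rfl⟩
  have one {N : Set (Arg L)} (hN : OneChild (Λ ∪ Γ) N)
      (hNχ : ∀ a ∈ N, ∃ φ, a = arg S₁ φ ∧ χ.Entails φ)
      (hred : Reduced {φ | arg S₁ φ ∈ Γ ∪ N} o χ) :
      ∃ Γ', Γ ⊆ Γ' ∧ LocallyOpen D S Λ Γ' ∧ Reduced {φ | arg S₁ φ ∈ Γ'} o χ :=
    ⟨_, Set.subset_union_left, h.extend_of_entails hχ hN hNχ, hred⟩
  have pair {φ ψ : Fml L 0} (hφ : χ.Entails φ) (hψ : χ.Entails ψ) :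
      ∀ a ∈ ({arg S₁ φ, arg S₁ ψ} : Set (Arg L)), ∃ φ, a = arg S₁ φ ∧ χ.Entails φ := by
    rintro a (rfl | rfl)
    · exact ⟨φ, rfl, hφ⟩
    · exact ⟨ψ, rfl, hψ⟩
  have single {φ : Fml L 0} (hφ : χ.Entails φ) :
      ∀ a ∈ ({arg S₁ φ} : Set (Arg L)), ∃ φ, a = arg S₁ φ ∧ χ.Entails φ := by
    rintro a rfl
    exact ⟨φ, rfl, hφ⟩
  have two {φ ψ : Fml L 0} (hb : Branches χ φ ψ)
      (hred : ∀ Γ' : Node L, arg S₁ φ ∈ Γ' ∨ arg S₁ ψ ∈ Γ' → Reduced {φ | arg S₁ φ ∈ Γ'} o χ) :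
      ∃ Γ', Γ ⊆ Γ' ∧ LocallyOpen D S Λ Γ' ∧ Reduced {φ | arg S₁ φ ∈ Γ'} o χ := by
    rcases h.split hχ hb with h' | h'
    · exact ⟨_, Set.subset_union_left, h', hred _ (Or.inl (Or.inr rfl))⟩
    · exact ⟨_, Set.subset_union_left, h', hred _ (Or.inr (Or.inr rfl))⟩
  have skip (hred : Reduced {φ | arg S₁ φ ∈ Γ} o χ) :
      ∃ Γ', Γ ⊆ Γ' ∧ LocallyOpen D S Λ Γ' ∧ Reduced {φ | arg S₁ φ ∈ Γ'} o χ :=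
    ⟨Γ, subset_rfl, h, hred⟩
  have hχ' : arg S₁ χ ∈ Λ ∪ Γ := Or.inr hχ
  cases χ with
  | rel R ts => exact skip trivial
  | bot => exact skip trivial
  | and φ ψ =>
    exact one (.and hχ') (pair (fun _ _ _ _ k => k.1) fun _ _ _ _ k => k.2)
      ⟨Or.inr (Or.inl rfl), Or.inr (Or.inr rfl)⟩
  | or φ ψ => exact two (.or φ ψ) fun _ k => k
  | imp φ ψ => exact two (.imp φ ψ) fun _ k => k
  | iff φ ψ =>
    exact one (.iff hχ') (pair (fun _ _ _ _ k => k.1) fun _ _ _ _ k => k.2)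
      ⟨Or.inr (Or.inl rfl), Or.inr (Or.inr rfl)⟩
  | all φ =>
    exact one (.all hχ' ht) (single fun M _ _ e k => (φ.realize_inst1 e t).2 (k _))
      ⟨t, hto, Or.inr rfl⟩
  | ex φ =>
    refine ⟨_, Set.subset_union_left, h.extend_witness hχ hc (.ex hχ' hc) ?_,
      ⟨.var c, Or.inr rfl⟩⟩
    rintro M _ _ e ⟨a, ha⟩
    refine ⟨a, (φ.realize_inst1 _ _).2 ?_⟩
    rw [Term.realize_var, Function.update_self]
    exact (Fml.realize_update (φ := φ) e c a (hc _ hχ').1 _).2 ha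
  | neg χ =>
    cases χ with
    | rel R ts => exact skip trivial
    | bot => exact skip trivial
    | neg φ =>
      exact one (.not_not hχ') (single fun _ _ _ _ k => not_not.1 k) (Or.inr rfl)
    | and φ ψ => exact two (.not_and φ ψ) fun _ k => k
    | or φ ψ =>
      exact one (.not_or hχ') (pair (fun _ _ _ _ k k' => k (Or.inl k'))
        fun _ _ _ _ k k' => k (Or.inr k')) ⟨Or.inr (Or.inl rfl), Or.inr (Or.inr rfl)⟩
    | imp φ ψ =>
      exact one (.not_imp hχ') (pair (fun _ _ _ _ k => (Classical.not_imp.1 k).1)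
        fun _ _ _ _ k => (Classical.not_imp.1 k).2) ⟨Or.inr (Or.inl rfl), Or.inr (Or.inr rfl)⟩
    | iff φ ψ => exact two (.not_iff φ ψ) fun _ k => k
    | all φ =>
      refine ⟨_, Set.subset_union_left, h.extend_witness hχ hc (.not_all hχ' hc) ?_,
        ⟨.var c, Or.inr rfl⟩⟩
      intro M _ _ e k
      obtain ⟨a, ha⟩ := not_forall.1 k
      refine ⟨a, fun k' => ha ?_⟩
      have k'' := (φ.realize_inst1 _ _).1 k'
      rw [Term.realize_var, Function.update_self] at k''
      exact (Fml.realize_update (φ := φ) e c a (hc _ hχ').1 _).1 k''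
    | ex φ =>
      exact one (.not_ex hχ' ht)
        (single fun M _ _ e k k' => k ⟨_, (φ.realize_inst1 e t).1 k'⟩) ⟨t, hto, Or.inr rfl⟩

/-! ### Completeness of the rewriting rules for local closures -/

theorem LocallyOpen.exists_forall_reduced (hΛ : {c | Fresh c Λ}.Infinite)
    (h : LocallyOpen D S Λ Γ) :
    ∃ Γ', Γ ⊆ Γ' ∧ LocallyOpen D S Λ Γ' ∧ ∀ S₁ χ, arg S₁ χ ∈ Γ → ∀ o : Option (L.Term ℕ),
      (∀ t ∈ o, TermOccurs t Γ) → Reduced {φ | arg S₁ φ ∈ Γ'} o χ := by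
  -- finitely many demands arise at `Γ`; they are met one after the other
  have terms : {t : L.Term ℕ | TermOccurs t Γ}.Finite := by
    refine (h.finite.biUnion fun a _ => a.2.finite_occurs).subset ?_
    rintro t ⟨a, ha, hat⟩
    exact Set.mem_biUnion ha hat
  have options : {o : Option (L.Term ℕ) | ∀ t ∈ o, TermOccurs t Γ}.Finite := by
    refine ((terms.image some).insert none).subset ?_
    rintro (_ | t) ht
    · exact Or.inl rfl
    · exact Or.inr ⟨t, ht t rfl, rfl⟩
  suffices key : ∀ Q : Set (Arg L × Option (L.Term ℕ)), Q.Finite →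
      Q ⊆ Γ ×ˢ {o | ∀ t ∈ o, TermOccurs t Γ} →
      ∃ Γ', Γ ⊆ Γ' ∧ LocallyOpen D S Λ Γ' ∧ ∀ S₁ χ o, (arg S₁ χ, o) ∈ Q →
        Reduced {φ | arg S₁ φ ∈ Γ'} o χ by
    obtain ⟨Γ', hΓ', ho, hr⟩ := key _ (h.finite.prod options) subset_rfl
    exact ⟨Γ', hΓ', ho, fun S₁ χ hχ o ho => hr S₁ χ o ⟨hχ, ho⟩⟩
  intro Q hQ
  induction Q, hQ using Set.Finite.induction_on with
  | empty => exact fun _ => ⟨Γ, subset_rfl, h, fun _ _ _ hm => hm.elim⟩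
  | @insert q Q _ _ ih =>
    intro hsub
    obtain ⟨Γ₁, hΓ₁, ho₁, hr₁⟩ := ih fun q hq => hsub (Or.inr hq)
    obtain ⟨⟨S₁, χ | ⟨η, μ⟩⟩, o⟩ := q
    · obtain ⟨hχ, ho⟩ := hsub (Or.inl rfl)
      obtain ⟨Γ₂, hΓ₂, ho₂, hr₂⟩ := ho₁.exists_reduced hΛ (hΓ₁ hχ) (o := o) fun t ht => by
        obtain ⟨a, ha, hat⟩ := ho t ht
        exact ⟨a, hΓ₁ ha, hat⟩
      refine ⟨Γ₂, hΓ₁.trans hΓ₂, ho₂, ?_⟩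
      rintro S₂ ψ o' (hm | hm)
      · cases hm; exact hr₂
      · exact (hr₁ S₂ ψ o' hm).of_mem_arg hΓ₂
    · refine ⟨Γ₁, hΓ₁, ho₁, ?_⟩
      rintro S₂ ψ o' (hm | hm)
      · cases hm
      · exact hr₁ S₂ ψ o' hm

/-- The propositions supported in a locally open set of arguments are consistent: they belong to
the Hintikka set that arises as the limit of repeated reduction. -/
theorem LocallyOpen.consistent (hΛ : {c | Fresh c Λ}.Infinite) (h : LocallyOpen D S Λ Γ) :
    Consistent {φ | ∃ S₁, arg S₁ φ ∈ Γ} := by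
  choose next hsub hopen hred using fun Γ : {Γ : Node L // LocallyOpen D S Λ Γ} =>
    Γ.2.exists_forall_reduced hΛ
  let seq : ℕ → {Γ : Node L // LocallyOpen D S Λ Γ} :=
    Nat.rec ⟨Γ, h⟩ fun _ Γ => ⟨next Γ, hopen Γ⟩
  have mono : Monotone fun n => (seq n).1 := monotone_nat_of_le_succ fun n => hsub (seq n)
  have hH : IsHintikka {φ | ∃ n S₁, arg S₁ φ ∈ (seq n).1} := by
    refine ⟨?_, ?_, ?_⟩
    · rintro ⟨n, S₁, hb⟩
      exact (seq n).2.bot_notMem S₁ hb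
    · rintro φ ⟨n, S₁, h₁⟩ ⟨m, S₂, h₂⟩
      exact (seq (max n m)).2.clash (mono (le_max_left n m) h₁) (mono (le_max_right n m) h₂)
    · rintro χ ⟨n, S₁, hχ⟩ o ho
      -- a stage at which both the formula and the term are present
      obtain ⟨m, hnm, hm⟩ : ∃ m ≥ n, ∀ t ∈ o, TermOccurs t (seq m).1 := by
        cases o with
        | none => exact ⟨n, le_rfl, fun t ht => by cases ht⟩
        | some t =>
          obtain ⟨φ, ⟨m, S₂, hφ⟩, hot⟩ := ho t rfl
          refine ⟨max n m, le_max_left n m, fun s hs => ?_⟩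
          cases hs
          exact ⟨_, mono (le_max_right n m) hφ, hot⟩
      refine (hred (seq m) S₁ χ (mono hnm hχ) o hm).mono ?_
      exact fun φ hφ => ⟨m + 1, S₁, hφ⟩
  obtain ⟨M, hM, hL, e, he⟩ := hH.consistent
  exact ⟨M, hM, hL, e, fun φ ⟨S₁, hφ⟩ => he φ ⟨0, S₁, hφ⟩⟩

/-- At a node at which all elements of a minimal inconsistent set `S` are available, a tableau
can be started for which `S` is a support for a local closure. -/
theorem exists_mem_localClosures (hΛ : {c | Fresh c Λ}.Infinite)
    (hS : ∀ e ∈ S, (({e}, e.hat) : Arg L) ∈ Λ) (inc : ¬ Consistent (hatSet S))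
    (min : ∀ S' : Finset (Elem L), S' ⊂ S → Consistent (hatSet S')) :
    ∃ U : Tree L, U.IsTableau D Λ ∧ S ∈ U.localClosures Λ := by
  let Γ : Node L := (fun e : Elem L => (({e}, e.hat) : Arg L)) '' S
  have hΓ {S₁ : Finset (Elem L)} {φ : Fml L 0} (h : arg S₁ φ ∈ Γ) :
      ∃ e ∈ S, S₁ = {e} ∧ e.hat = .prop φ := by
    obtain ⟨e, he, heq⟩ := h
    exact ⟨e, he, (congrArg Prod.fst heq).symm, congrArg Prod.snd heq⟩
  have hsub : Γ ⊆ Λ := by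
    rintro _ ⟨e, he, rfl⟩
    exact hS e he
  have hclos : LocallyClosable D S (Λ ∪ Γ) Γ := by
    by_contra hcon
    have hopen : LocallyOpen D S Λ Γ := by
      refine ⟨S.finite_toSet.image _, ?_, hcon⟩
      rintro _ ⟨e, he, rfl⟩
      exact Finset.singleton_subset_iff.2 he
    obtain ⟨M, hM, hL, v, hv⟩ := hopen.consistent hΛ
    refine inc ⟨M, hM, hL, v, ?_⟩
    rintro φ ⟨e, he, hφ⟩
    exact hv φ ⟨{e}, e, he, Prod.ext rfl hφ⟩
  rw [Set.union_eq_left.2 hsub] at hclos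
  obtain ⟨S', hS', hc, U, hU, hm⟩ := hclos
  -- the support of the local closure is inconsistent, so by minimality it is all of `S`
  have hnot : ¬ Consistent (hatSet S') := by
    rintro ⟨M, hM, hL, v, hv⟩
    refine hc ⟨M, hM, hL, v, ?_⟩
    rintro φ ⟨S₁, hS₁, hφ⟩
    obtain ⟨e, -, rfl, he⟩ := hΓ hφ
    exact hv φ ⟨e, Finset.singleton_subset_iff.1 hS₁, he⟩
  obtain rfl : S' = S := by
    by_contra hne
    exact hnot (min S' (Finset.ssubset_iff_subset_ne.2 ⟨hS', hne⟩))
  exact ⟨U, hU, hm⟩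

/-! ### Continuation of the leaves of a case -/

theorem Tree.Extends.refl (T : Tree L) : T.Extends T := by
  induction T with
  | leaf => trivial
  | extend N T ih => exact ⟨T, rfl, ih⟩
  | split S χ φ ψ T₁ T₂ ih₁ ih₂ => exact ⟨T₁, T₂, rfl, ih₁, ih₂⟩
  | apply S ρ aux T _ ih => exact ⟨T, rfl, ih⟩

/-- The leaves that remain in the case are continued, the others are left as they are; then `S` is
propagated to the root, since it decides at every split which children are needed. -/
theorem Tree.exists_extends_mem_localClosures (inc : ¬ Consistent (hatSet S))
    (min : ∀ S' : Finset (Elem L), S' ⊂ S → Consistent (hatSet S')) (T : Tree L) :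
    ∀ Γ : Node L, {c | Fresh c Γ}.Infinite → T.IsTableau D Γ → T.IsCase Γ S →
      ∃ T' : Tree L, T.Extends T' ∧ T'.IsTableau D Γ ∧ S ∈ T'.localClosures Γ := by
  induction T with
  | leaf =>
    intro Γ hΓ _ hS
    obtain ⟨U, hU, hm⟩ := exists_mem_localClosures (D := D) hΓ hS inc min
    exact ⟨U, trivial, hU, hm⟩
  | extend N T ih =>
    rintro Γ hΓ ⟨hN, hT⟩ hS
    obtain ⟨U, hTU, hU, hm⟩ := ih _ (infinite_fresh_union hΓ hN.finite) hT hS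
    exact ⟨.extend N U, ⟨U, rfl, hTU⟩, ⟨hN, hU⟩, Or.inr hm⟩
  | split S₀ χ φ ψ T₁ T₂ ih₁ ih₂ =>
    rintro Γ hΓ ⟨hχ, hb, hT₁, hT₂⟩ (⟨h₀, hS₁, hS₂⟩ | ⟨h₀, hS₁ | hS₂⟩)
    · obtain ⟨U₁, hTU₁, hU₁, hm₁⟩ := ih₁ _ (infinite_fresh_insert hΓ _) hT₁ hS₁
      obtain ⟨U₂, hTU₂, hU₂, hm₂⟩ := ih₂ _ (infinite_fresh_insert hΓ _) hT₂ hS₂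
      exact ⟨.split S₀ χ φ ψ U₁ U₂, ⟨U₁, U₂, rfl, hTU₁, hTU₂⟩, ⟨hχ, hb, hU₁, hU₂⟩,
        Or.inl (Or.inr ⟨S, hm₁, S, hm₂, h₀, h₀, (Finset.union_idempotent S).symm⟩)⟩
    · obtain ⟨U₁, hTU₁, hU₁, hm₁⟩ := ih₁ _ (infinite_fresh_insert hΓ _) hT₁ hS₁
      exact ⟨.split S₀ χ φ ψ U₁ T₂, ⟨U₁, T₂, rfl, hTU₁, .refl T₂⟩, ⟨hχ, hb, hU₁, hT₂⟩,
        Or.inr ⟨Or.inl hm₁, h₀⟩⟩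
    · obtain ⟨U₂, hTU₂, hU₂, hm₂⟩ := ih₂ _ (infinite_fresh_insert hΓ _) hT₂ hS₂
      exact ⟨.split S₀ χ φ ψ T₁ U₂, ⟨T₁, U₂, rfl, .refl T₁, hTU₂⟩, ⟨hχ, hb, hT₁, hU₂⟩,
        Or.inr ⟨Or.inr hm₂, h₀⟩⟩
  | apply S₀ ρ aux T _ ih =>
    rintro Γ hΓ ⟨hρ, haux, hcl, htest, hT⟩ hS
    obtain ⟨U, hTU, hU, hm⟩ := ih _ (infinite_fresh_insert hΓ _) hT hS
    exact ⟨.apply S₀ ρ aux U, ⟨U, rfl, hTU⟩, ⟨hρ, haux, hcl, htest, hU⟩, Or.inr hm⟩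

theorem fresh_rootNode {Prem : Set (Fml L 0)} {c : ℕ} (h : ∀ σ ∈ Prem, ¬ σ.Occurs (.var c)) :
    Fresh c (rootNode Prem) := by
  rintro _ ⟨σ, hσ, rfl⟩
  refine ⟨h σ hσ, fun e he hm => ?_⟩
  rw [Finset.mem_singleton.1 he, Elem.mentions_prem_iff] at hm
  exact h σ hσ hm

end ArgTableau

theorem mainTheorem5 {L : FirstOrder.Language.{u, v}}
    (Prem : Set (ArgTableau.Fml L 0)) (D : Set (Σ n, ArgTableau.Rule L n))
    (hPrem : {c : ℕ | ∀ σ ∈ Prem, ¬ σ.Occurs (FirstOrder.Language.Term.var c)}.Infinite)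
    (T : ArgTableau.Tree L) (hT : T.IsTableau D (ArgTableau.rootNode Prem))
    (S : Finset (ArgTableau.Elem L))
    (hS : ArgTableau.IsMinimalInconsistentCase T (ArgTableau.rootNode Prem) S) :
    ∃ T' : ArgTableau.Tree L, T.Extends T' ∧ T'.IsTableau D (ArgTableau.rootNode Prem) ∧
      S ∈ T'.localClosures (ArgTableau.rootNode Prem) :=
  T.exists_extends_mem_localClosures hS.inconsistent hS.minimal _
    (hPrem.mono fun _ hc => ArgTableau.fresh_rootNode hc) hT hS.isCase
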